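/- Let $r\ge 2$, $n=2^{2r}-1$ and $b=n/3$. Let $\alpha$ be a primitive element of the field $\mathbb{F}_{2^{2r}}$ (a generator of its multiplicative group) such that $\mathrm{Log}(1+\alpha)\not\equiv 2 \pmod 3$, where $\mathrm{Log}$ is the discrete logarithm to the base $\alpha$, i.e. $\mathrm{Log}(\beta)=\ell \iff \beta=\alpha^{\ell}$ for $0\le \ell<n$. Let $$H=\begin{bmatrix}1&\alpha&\alpha^2&\cdots&\alpha^{n-1}\\ 1&\alpha^b&(\alpha^b)^2&\cdots&(\alpha^b)^{n-1}\end{bmatrix}$$ and let $\mathcal{C}_r=\{\mathbf{c}\in\mathbb{F}_2^n : H\mathbf{c}^T=0\}$ be the binary cyclic code with parity-check matrix $H$. Let $|G\rangle\in(\mathbb{C}^2)^{\otimes n}$ be the one-dimensional cluster state with periodic boundary conditions on $n$ qubits, i.e. the unit vector (unique up to a global phase) with $X_iZ_{i-1}Z_{i+1}|G\rangle=|G\rangle$ for all $i$, indices modulo $n$. Then $$\mathcal{Q}_r=\mathrm{span}\{Z_{\mathbf{c}}|G\rangle : \mathbf{c}\in\mathcal{C}_r\},\qquad Z_{\mathbf{c}}=\prod_{j}Z_j^{c_j},$$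 is a pure $[[2^{2r}-1,\,2^{2r}-2r-3,\,3]]$ quantum error-correcting code. That is, $\dim\mathcal{Q}_r=2^{k}$ with $k=2^{2r}-2r-3$, and $\langle\psi|E|\psi\rangle=0$ for every $\psi\in\mathcal{Q}_r$ and every $n$-qubit Pauli operator $E$ of weight strictly between $0$ and $3$. -/

import Mathlib

noncomputable section

namespace CWS

/-- The state space `(ℂ²)^{⊗ n}` of `n` qubits with its Hilbert space structure, in the
computational basis: `ψ x` is the amplitude of the basis vector `|x₀ x₁ … xₙ₋₁⟩`. -/
abbrev QubitSpace (n : ℕ) : Type := EuclideanSpace ℂ (Fin n → Fin 2)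

/-- The four one-qubit Pauli labels. -/
inductive Pauli
  | I
  | X
  | Y
  | Z
  deriving DecidableEq

/-- The Pauli matrices. -/
def Pauli.toMatrix : Pauli → Matrix (Fin 2) (Fin 2) ℂ
  | Pauli.I => 1
  | Pauli.X => !![0, 1; 1, 0]
  | Pauli.Y => !![0, -Complex.I; Complex.I, 0]
  | Pauli.Z => !![1, 0; 0, -1]

/-- The matrix of `M 0 ⊗ M 1 ⊗ ⋯ ⊗ M (n - 1)` in the computational basis. -/
def tensorMatrix {n : ℕ} (M : Fin n → Matrix (Fin 2) (Fin 2) ℂ) :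
    Matrix (Fin n → Fin 2) (Fin n → Fin 2) ℂ :=
  Matrix.of fun x y => ∏ j, M j (x j) (y j)

/-- An element `i ^ phase • (σ⁽⁰⁾ ⊗ ⋯ ⊗ σ⁽ⁿ⁻¹⁾)` of the Pauli group on `n` qubits. -/
structure PauliOperator (n : ℕ) where
  /-- The exponent of the global phase. -/
  phase : Fin 4
  /-- The tensor factors. -/
  factor : Fin n → Pauli

/-- The operator on `n` qubits denoted by an element of the Pauli group. -/
def PauliOperator.toMatrix {n : ℕ} (E : PauliOperator n) :
    Matrix (Fin n → Fin 2) (Fin n → Fin 2) ℂ :=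
  Complex.I ^ (E.phase : ℕ) • tensorMatrix fun j => (E.factor j).toMatrix

/-- The weight of a Pauli operator: the number of qubits on which it is not the identity. -/
def PauliOperator.weight {n : ℕ} (E : PauliOperator n) : ℕ :=
  (Finset.univ.filter fun j => E.factor j ≠ Pauli.I).card

/-- The operator `X_a = ∏ j, X_j ^ (a j)` of a binary vector `a`. -/
def opX {n : ℕ} (a : Fin n → ZMod 2) : Matrix (Fin n → Fin 2) (Fin n → Fin 2) ℂ :=
  tensorMatrix fun j => if a j = 1 then Pauli.X.toMatrix else 1

/-- The operator `Z_a = ∏ j, Z_j ^ (a j)` of a binary vector `a`. -/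
def opZ {n : ℕ} (a : Fin n → ZMod 2) : Matrix (Fin n → Fin 2) (Fin n → Fin 2) ℂ :=
  tensorMatrix fun j => if a j = 1 then Pauli.Z.toMatrix else 1

/-- The action of a matrix on the state space. -/
def act {n : ℕ} (A : Matrix (Fin n → Fin 2) (Fin n → Fin 2) ℂ) :
    QubitSpace n →ₗ[ℂ] QubitSpace n :=
  Matrix.toEuclideanLin A

open scoped Classical in
/-- The stabilizer generator `S_i = X_i Z_{N(i)}` of a vertex `i` of a graph, where `N(i)` is the
set of neighbours of `i`. -/
def stabilizerGenerator {n : ℕ} (Γ : SimpleGraph (Fin n)) (i : Fin n) :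
    Matrix (Fin n → Fin 2) (Fin n → Fin 2) ℂ :=
  opX (fun j => if j = i then 1 else 0) * opZ (fun j => if Γ.Adj i j then 1 else 0)

/-- `ψ` is the graph state of `Γ` (a unit vector, determined up to a global phase): the
simultaneous `+1`-eigenstate of all the stabilizer generators. -/
def IsGraphState {n : ℕ} (Γ : SimpleGraph (Fin n)) (ψ : QubitSpace n) : Prop :=
  ‖ψ‖ = 1 ∧ ∀ i, act (stabilizerGenerator Γ i) ψ = ψ

section Existence

open Finset

lemma tensorMatrix_mul {n : ℕ} (A B : Fin n → Matrix (Fin 2) (Fin 2) ℂ) :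
    tensorMatrix A * tensorMatrix B = tensorMatrix fun j => A j * B j := by
  ext x y
  simp only [tensorMatrix, Matrix.mul_apply, Matrix.of_apply]
  rw [Finset.prod_univ_sum]
  simp [Finset.prod_mul_distrib]

/-- The sign contributed by the pair `j < k` to the amplitude of `|x⟩` in a graph state. -/
def pairSign {n : ℕ} (Γ : SimpleGraph (Fin n)) (x : Fin n → Fin 2) (j k : Fin n) : ℂ := by
  classical exact if j < k ∧ Γ.Adj j k ∧ x j = 1 ∧ x k = 1 then -1 else 1

/-- Flip the `i`-th bit. -/
def flipBit {n : ℕ} (i : Fin n) (x : Fin n → Fin 2) : Fin n → Fin 2 := Function.update x i (1 - x i)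

open scoped Classical in
lemma prod_pairSign {n : ℕ} (Γ : SimpleGraph (Fin n)) (x : Fin n → Fin 2) (i : Fin n) :
    (∏ j, ∏ k, pairSign Γ x j k) =
      ∏ k ∈ univ.erase i, ((if Γ.Adj i k ∧ x i = 1 ∧ x k = 1 then -1 else 1) *
        ∏ l ∈ univ.erase i, pairSign Γ x k l) := by
  rw [← mul_prod_erase univ _ (mem_univ i), ← mul_prod_erase univ (fun k => pairSign Γ x i k)
    (mem_univ i)]
  have h0 : pairSign Γ x i i = 1 := by simp [pairSign]
  rw [h0, one_mul, ← prod_mul_distrib]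
  refine prod_congr rfl fun k hk => ?_
  rw [← mul_prod_erase univ (fun l => pairSign Γ x k l) (mem_univ i), ← mul_assoc]
  congr 1
  have hki : k ≠ i := by simpa using hk
  simp only [pairSign, Γ.adj_comm k i]
  rcases lt_or_gt_of_ne hki with h | h
  · simp [h, not_lt.2 h.le]; grind
  · simp [h, not_lt.2 h.le]

open scoped Classical in
lemma prod_pairSign_flipBit {n : ℕ} (Γ : SimpleGraph (Fin n)) (x : Fin n → Fin 2) (i : Fin n) :
    (∏ k ∈ univ.erase i, if Γ.Adj i k ∧ x k = 1 then (-1 : ℂ) else 1) *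
    (∏ j, ∏ k, pairSign Γ (flipBit i x) j k) = (∏ j, ∏ k, pairSign Γ x j k) := by
  rw [prod_pairSign _ _ i, prod_pairSign _ _ i, ← prod_mul_distrib]
  refine prod_congr rfl fun k hk => ?_
  have hki : k ≠ i := by simpa using hk
  have h1 : flipBit i x k = x k := by simp [flipBit, hki]
  have h2 : flipBit i x i = 1 - x i := by simp [flipBit]
  rw [← mul_assoc]
  congr 1
  · rw [h1, h2]
    have : x i = 0 ∨ x i = 1 := by omega
    rcases this with h | h <;> by_cases h3 : Γ.Adj i k <;> by_cases h4 : x k = 1 <;> simp [*]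
  · refine prod_congr rfl fun l hl => ?_
    have hli : l ≠ i := by simpa using hl
    simp [pairSign, flipBit, hki, hli]

/-- Every graph has a graph state. -/
theorem exists_isGraphState {n : ℕ} (Γ : SimpleGraph (Fin n)) : ∃ ψ, IsGraphState Γ ψ := by
  classical
  suffices h : ∃ ψ : QubitSpace n, ψ ≠ 0 ∧ ∀ i, act (stabilizerGenerator Γ i) ψ = ψ by
    obtain ⟨ψ, h0, h⟩ := h
    refine ⟨((‖ψ‖⁻¹ : ℝ) : ℂ) • ψ, ?_, fun i => by rw [map_smul, h]⟩
    rw [norm_smul]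
    simp [h0]
  refine ⟨WithLp.toLp 2 fun x => ∏ j, ∏ k, pairSign Γ x j k, ?_, ?_⟩
  · intro h
    have := congrArg (fun ψ : QubitSpace n => ψ 0) h
    simp [pairSign] at this
  · intro i
    ext x
    simp only [act, Matrix.toEuclideanLin, Matrix.toLpLin_toLp, stabilizerGenerator, opX, opZ,
      tensorMatrix_mul]
    rw [Matrix.toLin'_apply, Matrix.mulVec, dotProduct, Finset.sum_eq_single (flipBit i x)]
    · rw [← prod_pairSign_flipBit Γ x i]
      congr 1
      simp only [tensorMatrix, Matrix.of_apply]
      rw [← mul_prod_erase univ _ (mem_univ i)]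
      have : x i = 0 ∨ x i = 1 := by omega
      have h1 : ((if i = i then (1:ZMod 2) else 0) = 1) := by simp
      rcases this with h | h
      · simp [Pauli.toMatrix, flipBit, h]
        refine prod_congr rfl fun k hk => ?_
        have hki : k ≠ i := by simpa using hk
        have : x k = 0 ∨ x k = 1 := by omega
        by_cases h3 : Γ.Adj i k <;> rcases this with h4 | h4 <;> simp [hki, h3, h4, Matrix.one_apply]
      · simp [Pauli.toMatrix, flipBit, h]
        refine prod_congr rfl fun k hk => ?_
        have hki : k ≠ i := by simpa using hk
        have : x k = 0 ∨ x k = 1 := by omega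
        by_cases h3 : Γ.Adj i k <;> rcases this with h4 | h4 <;> simp [hki, h3, h4, Matrix.one_apply]
    · intro y _ hy
      obtain ⟨k, hk⟩ := Function.ne_iff.1 hy
      refine mul_eq_zero_of_left ?_ _
      simp only [tensorMatrix, Matrix.of_apply]
      refine prod_eq_zero (mem_univ k) ?_
      by_cases hki : k = i
      · subst hki
        simp [flipBit] at hk
        have h5 : x k = 0 ∨ x k = 1 := by omega
        have h6 : y k = 0 ∨ y k = 1 := by omega
        rcases h5 with h5 | h5 <;> rcases h6 with h6 | h6 <;> simp_all [Pauli.toMatrix]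
      · have hk' : y k ≠ x k := by simpa [flipBit, hki] using hk
        simp [hki]
        by_cases h3 : Γ.Adj i k <;> simp [h3, Pauli.toMatrix, hk'.symm]
        have h5 : x k = 0 ∨ x k = 1 := by omega
        have h6 : y k = 0 ∨ y k = 1 := by omega
        rcases h5 with h5 | h5 <;> rcases h6 with h6 | h6 <;> simp_all
    · simp

end Existence

/-- The Lee distance on `{0, …, n - 1}`. -/
def leeDist {n : ℕ} (x y : Fin n) : ℕ :=
  min (((x : ℕ) : ℤ) - ((y : ℕ) : ℤ)).natAbs (n - (((x : ℕ) : ℤ) - ((y : ℕ) : ℤ)).natAbs)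

/-- The one-dimensional lattice with periodic boundary conditions on `{0, …, n - 1}`: two
vertices are adjacent iff their Lee distance is `1`. -/
def lattice (n : ℕ) : SimpleGraph (Fin n) where
  Adj x y := leeDist x y = 1
  symm := ⟨fun x y h => by unfold leeDist at *; omega⟩
  loopless := ⟨fun x h => by unfold leeDist at h; omega⟩

/-- The CWS code `span {Z_c |G⟩ : c ∈ C}`. -/
def cwsCode {n : ℕ} (G : QubitSpace n) (C : Submodule (ZMod 2) (Fin n → ZMod 2)) :
    Submodule ℂ (QubitSpace n) :=
  Submodule.span ℂ {ψ | ∃ c ∈ C, ψ = act (opZ c) G}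

/-- `Q` is a pure `[[n, k, d]]` quantum code: it has dimension `2 ^ k`, and `⟨ψ|E|ψ⟩ = 0` for
every `ψ ∈ Q` and every Pauli operator `E` of weight strictly between `0` and `d`. -/
def IsPureQECC (n k d : ℕ) (Q : Submodule ℂ (QubitSpace n)) : Prop :=
  Module.finrank ℂ Q = 2 ^ k ∧
    ∀ E : PauliOperator n, 0 < E.weight → E.weight < d →
      ∀ ψ ∈ Q, inner ℂ ψ (act E.toMatrix ψ) = 0

/-- The binary linear code of length `n` with parity-check matrix `H` over an extension field
of `𝔽₂`: the binary vectors `c` with `H cᵀ = 0`. -/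
def parityCheckCode {F : Type*} [Field F] [Algebra (ZMod 2) F] {m n : ℕ}
    (H : Matrix (Fin m) (Fin n) F) : Submodule (ZMod 2) (Fin n → ZMod 2) where
  carrier := {c | H.mulVec (fun j => algebraMap (ZMod 2) F (c j)) = 0}
  add_mem' {c d} hc hd := by
    have h : (fun j => algebraMap (ZMod 2) F ((c + d) j)) =
        (fun j => algebraMap (ZMod 2) F (c j)) + fun j => algebraMap (ZMod 2) F (d j) := by
      ext j; simp
    simp only [Set.mem_ofPred_eq] at *
    rw [h, Matrix.mulVec_add, hc, hd, add_zero]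
  zero_mem' := by
    have h : (fun j => algebraMap (ZMod 2) F ((0 : Fin n → ZMod 2) j)) = 0 := by
      ext j; simp
    simp only [Set.mem_ofPred_eq]
    rw [h, Matrix.mulVec_zero]
  smul_mem' a c hc := by
    have h : (fun j => algebraMap (ZMod 2) F ((a • c) j)) =
        algebraMap (ZMod 2) F a • fun j => algebraMap (ZMod 2) F (c j) := by
      ext j; simp
    simp only [Set.mem_ofPred_eq] at *
    rw [h, Matrix.mulVec_smul, hc, smul_zero]

/-- The `2 × n` matrix with rows `(α ^ j)` and `((α ^ b) ^ j)`, `0 ≤ j < n`. -/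
def parityCheckMatrix {F : Type*} [Field F] (n b : ℕ) (α : F) : Matrix (Fin 2) (Fin n) F :=
  Matrix.of ![fun j => α ^ (j : ℕ), fun j => (α ^ b) ^ (j : ℕ)]

/-- The code `C_r` of length `n = 2 ^ (2 r) - 1`, with `b = n / 3`. -/
def tentPegCode {F : Type*} [Field F] [Algebra (ZMod 2) F] (r : ℕ) (α : F) :
    Submodule (ZMod 2) (Fin (2 ^ (2 * r) - 1) → ZMod 2) :=
  parityCheckCode (parityCheckMatrix (2 ^ (2 * r) - 1) ((2 ^ (2 * r) - 1) / 3) α)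

/-- The discrete logarithm of `β` to the base `α`: the least `ℓ` with `α ^ ℓ = β`. It is used only
where such an `ℓ` exists. -/
def discreteLog {F : Type*} [Field F] (α β : F) : ℕ :=
  sInf {ℓ : ℕ | α ^ ℓ = β}

end CWS

end

/-! On the graph state, `X_i` acts as `Z_{N(i)}`, so every Pauli operator sends `Z_c G` to a
multiple of `Z_{c+w} G`, with `w` depending only on the operator. The vectors `Z_c G` are
orthogonal, being joint eigenvectors of the stabilizer generators with different sign patterns
(`IsGraphState.inner_opZ`). Hence the quantum dimension is `2 ^ dim C`, and purity reduces to a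
classical statement: no `w` arising from an error of weight 1 or 2 lies in `C`
(`IsGraphState.isPureQECC_cwsCode`).

Read binary vectors as polynomials and put `ω = α ^ b`, a primitive cube root of unity. On the
cycle, the errors `Z_i`, `X_i`, `Y_i` evaluate at an `n`-th root of unity `β` to `β^i`, `β^i (β +
β⁻¹)`, `β^i (β + 1 + β⁻¹)`. At `ω` these are `ω^i`, `ω^i`, `0`. Comparing the values at `α` and `ω`
leaves one dangerous pair, an `X` and a `Z`, which the condition on the logarithm excludes
(`inducedVec_add_inducedVec_notMem`). The dimension of `C` follows from the coprimality of the
minimal polynomials of `α` and `ω`, of degrees `2r` and 2 (`finrank_parityCheckCode`). -/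

namespace CWS

open Finset Matrix

/-! ### Algebra of Pauli operators -/

section Operators

variable {n : ℕ}

lemma tensorMatrix_smul (s : Fin n → ℂ) (M : Fin n → Matrix (Fin 2) (Fin 2) ℂ) :
    tensorMatrix (fun j => s j • M j) = (∏ j, s j) • tensorMatrix M := by
  ext x y
  simp [tensorMatrix, Finset.prod_mul_distrib]

lemma tensorMatrix_one : tensorMatrix (fun _ : Fin n => (1 : Matrix (Fin 2) (Fin 2) ℂ)) = 1 := by
  ext x y
  simp only [tensorMatrix, Matrix.of_apply, Matrix.one_apply]
  by_cases h : x = y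
  · simp [h]
  · obtain ⟨k, hk⟩ := Function.ne_iff.1 h
    rw [if_neg h]
    exact prod_eq_zero (mem_univ k) (by simp [hk])

lemma tensorMatrix_conjTranspose (M : Fin n → Matrix (Fin 2) (Fin 2) ℂ) :
    (tensorMatrix M)ᴴ = tensorMatrix fun j => (M j)ᴴ := by
  ext x y
  simp [tensorMatrix, Matrix.conjTranspose_apply]

lemma Pauli.Z_mul_Z : Pauli.Z.toMatrix * Pauli.Z.toMatrix = 1 := by
  ext i j; fin_cases i <;> fin_cases j <;> simp [Pauli.toMatrix]

lemma Pauli.X_mul_Z :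
    Pauli.X.toMatrix * Pauli.Z.toMatrix = (-1 : ℂ) • (Pauli.Z.toMatrix * Pauli.X.toMatrix) := by
  ext i j; fin_cases i <;> fin_cases j <;> simp [Pauli.toMatrix]

lemma Pauli.Y_eq :
    Pauli.Y.toMatrix = Complex.I • (Pauli.X.toMatrix * Pauli.Z.toMatrix) := by
  ext i j; fin_cases i <;> fin_cases j <;> simp [Pauli.toMatrix]

lemma Pauli.X_conjTranspose : Pauli.X.toMatrixᴴ = Pauli.X.toMatrix := by
  ext i j; fin_cases i <;> fin_cases j <;> simp [Pauli.toMatrix, Matrix.conjTranspose_apply]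

lemma Pauli.Z_conjTranspose : Pauli.Z.toMatrixᴴ = Pauli.Z.toMatrix := by
  ext i j; fin_cases i <;> fin_cases j <;> simp [Pauli.toMatrix, Matrix.conjTranspose_apply]

lemma zmod_two_cases (a : ZMod 2) : a = 0 ∨ a = 1 := by
  revert a; decide

lemma opZ_mul_opZ (v w : Fin n → ZMod 2) : opZ v * opZ w = opZ (v + w) := by
  rw [opZ, opZ, opZ, tensorMatrix_mul]
  congr 1
  funext j
  have h11 : (1 + 1 : ZMod 2) = 0 := by decide
  rcases zmod_two_cases (v j) with h | h <;> rcases zmod_two_cases (w j) with h' | h' <;>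
    simp [h, h', Pauli.Z_mul_Z, h11]

lemma opZ_zero : opZ (0 : Fin n → ZMod 2) = 1 := by
  simp [opZ, tensorMatrix_one]

lemma opZ_mul_self (v : Fin n → ZMod 2) : opZ v * opZ v = 1 := by
  have h : v + v = 0 := funext fun j => CharTwo.add_self_eq_zero (v j)
  rw [opZ_mul_opZ, h, opZ_zero]

lemma opZ_conjTranspose (v : Fin n → ZMod 2) : (opZ v)ᴴ = opZ v := by
  rw [opZ, tensorMatrix_conjTranspose]
  congr 1
  funext j
  split_ifs <;> simp [Pauli.Z_conjTranspose]

lemma opX_conjTranspose (v : Fin n → ZMod 2) : (opX v)ᴴ = opX v := by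
  rw [opX, tensorMatrix_conjTranspose]
  congr 1
  funext j
  split_ifs <;> simp [Pauli.X_conjTranspose]

/-- The unit vector at `i`, as it occurs in `stabilizerGenerator`. -/
def unitVec (i : Fin n) : Fin n → ZMod 2 := fun j => if j = i then 1 else 0

/-- The sign `(-1) ^ a`. -/
def signOf (a : ZMod 2) : ℂ := if a = 1 then -1 else 1

lemma opX_unitVec_mul_opZ (i : Fin n) (c : Fin n → ZMod 2) :
    opX (unitVec i) * opZ c = signOf (c i) • (opZ c * opX (unitVec i)) := by
  -- Spreading the scalar over the sites lets the identity be checked factor by factor.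
  have h : signOf (c i) = ∏ j, if j = i then signOf (c i) else 1 := by simp
  rw [opX, opZ, tensorMatrix_mul, tensorMatrix_mul, h, ← tensorMatrix_smul]
  congr 1
  funext j
  by_cases hj : j = i
  · subst hj
    rcases zmod_two_cases (c j) with h | h <;> simp [unitVec, signOf, h, Pauli.X_mul_Z]
  · simp [unitVec, hj]

/-- The Pauli matrix `P` acting on the qubit `i`. -/
def siteOp (i : Fin n) (P : Pauli) : Matrix (Fin n → Fin 2) (Fin n → Fin 2) ℂ :=
  tensorMatrix fun j => if j = i then P.toMatrix else 1

lemma siteOp_I (i : Fin n) : siteOp i Pauli.I = 1 := by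
  simp [siteOp, Pauli.toMatrix, tensorMatrix_one]

lemma siteOp_X (i : Fin n) : siteOp i Pauli.X = opX (unitVec i) := by
  rw [siteOp, opX]
  congr 1
  funext j
  by_cases hj : j = i <;> simp [unitVec, hj]

lemma siteOp_Z (i : Fin n) : siteOp i Pauli.Z = opZ (unitVec i) := by
  rw [siteOp, opZ]
  congr 1
  funext j
  by_cases hj : j = i <;> simp [unitVec, hj]

lemma siteOp_Y (i : Fin n) :
    siteOp i Pauli.Y = Complex.I • (siteOp i Pauli.X * siteOp i Pauli.Z) := by
  have h : Complex.I = ∏ j, if j = i then Complex.I else 1 := by simp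
  conv_rhs => rw [siteOp, siteOp, tensorMatrix_mul, h, ← tensorMatrix_smul]
  rw [siteOp]
  congr 1
  funext j
  by_cases hj : j = i <;> simp [hj, Pauli.Y_eq]

lemma act_mul (A B : Matrix (Fin n → Fin 2) (Fin n → Fin 2) ℂ) (ψ : QubitSpace n) :
    act (A * B) ψ = act A (act B ψ) := by
  ext x
  simp [act, Matrix.toEuclideanLin, Matrix.mulVec_mulVec]

lemma act_one (ψ : QubitSpace n) : act 1 ψ = ψ := by
  ext x
  simp [act, Matrix.toEuclideanLin]

lemma act_smul (s : ℂ) (A : Matrix (Fin n → Fin 2) (Fin n → Fin 2) ℂ) (ψ : QubitSpace n) :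
    act (s • A) ψ = s • act A ψ := by
  simp [act]

lemma inner_act (A : Matrix (Fin n → Fin 2) (Fin n → Fin 2) ℂ) (φ ψ : QubitSpace n) :
    inner ℂ (act A φ) ψ = inner ℂ φ (act Aᴴ ψ) := by
  rw [act, act, Matrix.toEuclideanLin_conjTranspose_eq_adjoint, LinearMap.adjoint_inner_right]

end Operators

/-! ### Errors on graph states and the reduction to a classical code -/

section GraphState

variable {n : ℕ} {Γ : SimpleGraph (Fin n)} {G : QubitSpace n}

open scoped Classical in
/-- The indicator vector of the neighbourhood of `i`. -/
noncomputable def neighborVec (Γ : SimpleGraph (Fin n)) (i : Fin n) : Fin n → ZMod 2 :=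
  fun j => if Γ.Adj i j then 1 else 0

lemma stabilizerGenerator_eq (Γ : SimpleGraph (Fin n)) (i : Fin n) :
    stabilizerGenerator Γ i = opX (unitVec i) * opZ (neighborVec Γ i) := rfl

lemma opX_unitVec_comm_opZ_neighborVec (Γ : SimpleGraph (Fin n)) (i : Fin n) :
    opX (unitVec i) * opZ (neighborVec Γ i) = opZ (neighborVec Γ i) * opX (unitVec i) := by
  rw [opX_unitVec_mul_opZ]
  simp [neighborVec, signOf]

lemma stabilizerGenerator_conjTranspose (Γ : SimpleGraph (Fin n)) (i : Fin n) :
    (stabilizerGenerator Γ i)ᴴ = stabilizerGenerator Γ i := by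
  rw [stabilizerGenerator_eq, Matrix.conjTranspose_mul, opX_conjTranspose, opZ_conjTranspose,
    opX_unitVec_comm_opZ_neighborVec]

/-- The generator `X_i Z_{N(i)}` fixes `G` and `Z_{N(i)}` is an involution; this turns bit flips
into phase flips. -/
lemma IsGraphState.act_opX (hG : IsGraphState Γ G) (i : Fin n) :
    act (opX (unitVec i)) G = act (opZ (neighborVec Γ i)) G := by
  have h := hG.2 i
  rw [stabilizerGenerator_eq, opX_unitVec_comm_opZ_neighborVec] at h
  conv_rhs => rw [← h, ← act_mul, ← mul_assoc, opZ_mul_self, one_mul]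

lemma IsGraphState.act_stabilizerGenerator_opZ (hG : IsGraphState Γ G) (i : Fin n)
    (c : Fin n → ZMod 2) :
    act (stabilizerGenerator Γ i) (act (opZ c) G) = signOf (c i) • act (opZ c) G := by
  have h : stabilizerGenerator Γ i * opZ c = signOf (c i) • (opZ c * stabilizerGenerator Γ i) := by
    rw [stabilizerGenerator_eq, mul_assoc, opZ_mul_opZ, add_comm, ← opZ_mul_opZ, ← mul_assoc,
      opX_unitVec_mul_opZ, smul_mul_assoc, mul_assoc]
  rw [← act_mul, h, act_smul, act_mul, hG.2 i]

/-- At a coordinate where `c` and `d` differ, the Hermitian generator has opposite eigenvalues on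
the two vectors, so their inner product equals its own negative. -/
lemma IsGraphState.inner_opZ (hG : IsGraphState Γ G) {c d : Fin n → ZMod 2} (hcd : c ≠ d) :
    inner ℂ (act (opZ c) G) (act (opZ d) G) = 0 := by
  obtain ⟨i, hi⟩ := Function.ne_iff.1 hcd
  have h := inner_act (stabilizerGenerator Γ i) (act (opZ c) G) (act (opZ d) G)
  rw [stabilizerGenerator_conjTranspose, hG.act_stabilizerGenerator_opZ,
    hG.act_stabilizerGenerator_opZ, inner_smul_left, inner_smul_right] at h
  rcases zmod_two_cases (c i) with h1 | h1 <;> rcases zmod_two_cases (d i) with h2 | h2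
  · exact absurd (h1.trans h2.symm) hi
  · simp only [h1, h2, signOf] at h
    simpa [self_eq_neg] using h
  · simp only [h1, h2, signOf] at h
    simpa [neg_eq_self] using h
  · exact absurd (h1.trans h2.symm) hi

lemma IsGraphState.opZ_ne_zero (hG : IsGraphState Γ G) (c : Fin n → ZMod 2) :
    act (opZ c) G ≠ 0 := by
  intro h
  have h1 : act (opZ c) (act (opZ c) G) = 0 := by rw [h, map_zero]
  rw [← act_mul, opZ_mul_self, act_one] at h1
  simpa [h1] using hG.1

lemma IsGraphState.linearIndependent_opZ (hG : IsGraphState Γ G) :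
    LinearIndependent ℂ fun c : Fin n → ZMod 2 => act (opZ c) G :=
  linearIndependent_of_ne_zero_of_inner_eq_zero hG.opZ_ne_zero fun _ _ h => hG.inner_opZ h

lemma IsGraphState.finrank_cwsCode (hG : IsGraphState Γ G)
    (C : Submodule (ZMod 2) (Fin n → ZMod 2)) :
    Module.finrank ℂ (cwsCode G C) = 2 ^ Module.finrank (ZMod 2) C := by
  classical
  have h := finrank_span_eq_card (hG.linearIndependent_opZ.comp (fun c : C => c.1)
    Subtype.val_injective)
  have hset : {ψ | ∃ c ∈ C, ψ = act (opZ c) G} =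
      Set.range ((fun c : Fin n → ZMod 2 => act (opZ c) G) ∘ fun c : C => c.1) := by
    ext ψ
    simp [eq_comm]
  have hcard : Fintype.card C = 2 ^ Module.finrank (ZMod 2) C := by
    rw [Module.card_eq_pow_finrank (K := ZMod 2), ZMod.card]
  rw [cwsCode, hset, h, hcard]

/-- The vector `w` such that the Pauli matrix `P` on the qubit `i` acts on the graph state as
`Z_w`, up to a phase. -/
noncomputable def inducedVec (Γ : SimpleGraph (Fin n)) (i : Fin n) : Pauli → Fin n → ZMod 2
  | Pauli.I => 0
  | Pauli.X => neighborVec Γ i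
  | Pauli.Y => neighborVec Γ i + unitVec i
  | Pauli.Z => unitVec i

lemma IsGraphState.act_siteOp (hG : IsGraphState Γ G) (i : Fin n) (P : Pauli)
    (c : Fin n → ZMod 2) :
    ∃ s : ℂ, act (siteOp i P) (act (opZ c) G) = s • act (opZ (c + inducedVec Γ i P)) G := by
  have hX : ∀ c : Fin n → ZMod 2, act (opX (unitVec i)) (act (opZ c) G) =
      signOf (c i) • act (opZ (c + neighborVec Γ i)) G := fun c => by
    rw [← act_mul, opX_unitVec_mul_opZ, act_smul, act_mul, hG.act_opX, ← act_mul, opZ_mul_opZ]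
  cases P with
  | I => exact ⟨1, by simp [siteOp_I, act_one, inducedVec]⟩
  | X => exact ⟨_, by rw [siteOp_X, hX]; rfl⟩
  | Z => exact ⟨1, by rw [siteOp_Z, ← act_mul, opZ_mul_opZ, add_comm, one_smul]; rfl⟩
  | Y =>
    refine ⟨Complex.I * signOf ((unitVec i + c) i), ?_⟩
    rw [siteOp_Y, act_smul, act_mul, siteOp_Z, siteOp_X, ← act_mul (opZ _), opZ_mul_opZ, hX,
      smul_smul, inducedVec, add_comm (unitVec i) c, add_assoc, add_comm (unitVec i)]

lemma PauliOperator.toMatrix_eq_siteOp (E : PauliOperator n) {i j : Fin n} (hij : i ≠ j)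
    (h : ∀ k, k ≠ i → k ≠ j → E.factor k = Pauli.I) :
    E.toMatrix = Complex.I ^ (E.phase : ℕ) • (siteOp i (E.factor i) * siteOp j (E.factor j)) := by
  rw [PauliOperator.toMatrix, siteOp, siteOp, tensorMatrix_mul]
  congr 2
  funext k
  by_cases hi : k = i
  · subst hi; simp [hij]
  · by_cases hj : k = j
    · subst hj; simp [hi]
    · simp [hi, hj, h k hi hj, Pauli.toMatrix]

/-- Treats weights 1 and 2 uniformly: in weight 1 the second site is arbitrary and carries the
identity. -/
lemma PauliOperator.exists_pair (E : PauliOperator n) (hn : 2 ≤ n) (h0 : 0 < E.weight)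
    (h2 : E.weight < 3) :
    ∃ i j, i ≠ j ∧ E.factor i ≠ Pauli.I ∧ ∀ k, k ≠ i → k ≠ j → E.factor k = Pauli.I := by
  unfold PauliOperator.weight at h0 h2
  obtain ⟨i, hi⟩ := card_pos.1 h0
  have : Nontrivial (Fin n) := Fin.nontrivial_iff_two_le.2 hn
  have hi' : E.factor i ≠ Pauli.I := by simpa using hi
  by_cases hj : ∃ j, j ≠ i ∧ E.factor j ≠ Pauli.I
  · obtain ⟨j, hji, hj⟩ := hj
    refine ⟨i, j, hji.symm, hi', fun k hki hkj => ?_⟩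
    by_contra hk
    have hsub : ({i, j, k} : Finset (Fin n)) ⊆ univ.filter fun j => E.factor j ≠ Pauli.I := by
      intro l hl
      simp only [mem_insert, mem_singleton] at hl
      rcases hl with rfl | rfl | rfl <;> simpa
    have := card_le_card hsub
    rw [card_eq_three.2 ⟨i, j, k, hji.symm, hki.symm, hkj.symm, rfl⟩] at this
    omega
  · push Not at hj
    obtain ⟨j, hj'⟩ := exists_ne i
    exact ⟨i, j, hj'.symm, hi', fun k hk _ => hj k hk⟩

/-- Translation by `w ∉ C` moves `C` off itself, so `A` maps the code into its orthogonal
complement. Independent `φ` and `ψ` allow a separate span induction in each slot. -/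
lemma IsGraphState.inner_cwsCode_eq_zero (hG : IsGraphState Γ G)
    (C : Submodule (ZMod 2) (Fin n → ZMod 2)) {w : Fin n → ZMod 2} (hw : w ∉ C)
    (A : Matrix (Fin n → Fin 2) (Fin n → Fin 2) ℂ)
    (hA : ∀ c, ∃ s : ℂ, act A (act (opZ c) G) = s • act (opZ (c + w)) G)
    {φ ψ : QubitSpace n} (hφ : φ ∈ cwsCode G C) (hψ : ψ ∈ cwsCode G C) :
    inner ℂ φ (act A ψ) = 0 := by
  induction hφ using Submodule.span_induction with
  | zero => simp
  | add x y _ _ hx hy => rw [inner_add_left, hx, hy, add_zero]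
  | smul a x _ hx => rw [inner_smul_left, hx, mul_zero]
  | mem x hx =>
    obtain ⟨d, hd, rfl⟩ := hx
    induction hψ using Submodule.span_induction with
    | zero => simp
    | add x y _ _ hx hy => rw [map_add, inner_add_right, hx, hy, add_zero]
    | smul a x _ hx => rw [map_smul, inner_smul_right, hx, mul_zero]
    | mem y hy =>
      obtain ⟨c, hc, rfl⟩ := hy
      obtain ⟨s, hs⟩ := hA c
      rw [hs, inner_smul_right, hG.inner_opZ, mul_zero]
      rintro rfl
      exact hw ((Submodule.add_mem_iff_right C hc).1 hd)

lemma IsGraphState.isPureQECC_cwsCode (hG : IsGraphState Γ G) (hn : 2 ≤ n)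
    (C : Submodule (ZMod 2) (Fin n → ZMod 2)) {k : ℕ} (hk : Module.finrank (ZMod 2) C = k)
    (hC : ∀ i j P Q, i ≠ j → P ≠ Pauli.I → inducedVec Γ i P + inducedVec Γ j Q ∉ C) :
    IsPureQECC n k 3 (cwsCode G C) := by
  refine ⟨by rw [hG.finrank_cwsCode, hk], fun E h0 h3 ψ hψ => ?_⟩
  obtain ⟨i, j, hij, hi, h⟩ := E.exists_pair hn h0 h3
  refine hG.inner_cwsCode_eq_zero C (hC i j (E.factor i) (E.factor j) hij hi) _ (fun c => ?_) hψ hψ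
  obtain ⟨s, hs⟩ := hG.act_siteOp j (E.factor j) c
  obtain ⟨t, ht⟩ := hG.act_siteOp i (E.factor i) (c + inducedVec Γ j (E.factor j))
  refine ⟨Complex.I ^ (E.phase : ℕ) * (s * t), ?_⟩
  rw [E.toMatrix_eq_siteOp hij h, act_smul, act_mul, hs, map_smul, ht, smul_smul, smul_smul, mul_assoc,
    add_assoc, add_comm (inducedVec Γ j _)]

end GraphState

/-! ### Neighbourhoods in the cycle -/

section Lattice

/-- The neighbours are the cyclic successor and predecessor. With `n = 2` they would coincide and
the sum would cancel. -/
lemma exists_neighborVec_lattice {n : ℕ} (hn : 3 ≤ n) (i : Fin n) :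
    ∃ s p : Fin n, (s : ℕ) = (i + 1) % n ∧ (p + 1) % n = (i : ℕ) ∧
      neighborVec (lattice n) i = unitVec s + unitVec p := by
  have hi := i.2
  have hs : ((i : ℕ) + 1) % n = if (i : ℕ) + 1 = n then 0 else (i : ℕ) + 1 := by
    split_ifs with h
    · rw [h, Nat.mod_self]
    · exact Nat.mod_eq_of_lt (by omega)
  have hp : ((if (i : ℕ) = 0 then n - 1 else (i : ℕ) - 1) + 1) % n = (i : ℕ) := by
    split_ifs with h
    · rw [Nat.sub_add_cancel (by omega), Nat.mod_self, h]
    · rw [Nat.sub_add_cancel (by omega), Nat.mod_eq_of_lt hi]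
  refine ⟨⟨(i + 1) % n, Nat.mod_lt _ (by omega)⟩,
    ⟨if (i : ℕ) = 0 then n - 1 else (i : ℕ) - 1, by split_ifs <;> omega⟩, rfl, hp, ?_⟩
  funext j
  have hj := j.2
  have hadj : (lattice n).Adj i j ↔ (j : ℕ) = (i + 1) % n ∨
      (j : ℕ) = if (i : ℕ) = 0 then n - 1 else (i : ℕ) - 1 := by
    simp only [lattice, leeDist, hs]
    split_ifs <;> omega
  have hne : ¬((j : ℕ) = (i + 1) % n ∧ (j : ℕ) = if (i : ℕ) = 0 then n - 1 else (i : ℕ) - 1) := by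
    rw [hs]
    split_ifs <;> omega
  simp only [neighborVec, unitVec, Pi.add_apply, Fin.ext_iff, hadj]
  generalize (i + 1) % n = s at hne ⊢
  generalize (if (i : ℕ) = 0 then n - 1 else (i : ℕ) - 1) = p at hne ⊢
  by_cases h1 : (j : ℕ) = s
  · have h2 : (j : ℕ) ≠ p := fun h => hne ⟨h1, h⟩
    rw [if_pos (Or.inl h1), if_pos h1, if_neg h2, add_zero]
  · by_cases h2 : (j : ℕ) = p
    · rw [if_pos (Or.inr h2), if_neg h1, if_pos h2, zero_add]
    · rw [if_neg (not_or.2 ⟨h1, h2⟩), if_neg h1, if_neg h2, zero_add]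

end Lattice

/-! ### Dimension of the cyclic code and detection of errors -/

section Code

variable {F : Type*} [Field F] [Algebra (ZMod 2) F]

/-- The evaluation `v ↦ ∑ j, v j * β ^ j` of the polynomial with coefficient vector `v`. -/
def evalVec (n : ℕ) (β : F) : (Fin n → ZMod 2) →ₗ[ZMod 2] F :=
  Fintype.linearCombination (ZMod 2) fun j : Fin n => β ^ (j : ℕ)

lemma evalVec_apply {n : ℕ} (β : F) (v : Fin n → ZMod 2) :
    evalVec n β v = ∑ j, v j • β ^ (j : ℕ) := by
  simp [evalVec, Fintype.linearCombination_apply]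

lemma evalVec_unitVec {n : ℕ} (β : F) (i : Fin n) : evalVec n β (unitVec i) = β ^ (i : ℕ) := by
  simp [evalVec_apply, unitVec]

lemma evalVec_neighborVec {n : ℕ} (hn : 3 ≤ n) {β : F} (hβ : β ^ n = 1) (i : Fin n) :
    evalVec n β (neighborVec (lattice n) i) = β ^ (i : ℕ) * (β + β⁻¹) := by
  obtain ⟨s, p, hs, hp, h⟩ := exists_neighborVec_lattice hn i
  have hp' : β ^ (i : ℕ) = β ^ (p + 1 : ℕ) := by rw [← hp, ← pow_eq_pow_mod _ hβ]
  have hβ0 : β ≠ 0 := by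
    rintro rfl
    rw [zero_pow (by omega)] at hβ
    exact zero_ne_one hβ
  rw [h, map_add, evalVec_unitVec, evalVec_unitVec, hs, ← pow_eq_pow_mod _ hβ, pow_succ, hp',
    pow_succ]
  field_simp

lemma mem_parityCheckCode_iff {n b : ℕ} {α : F} {v : Fin n → ZMod 2} :
    v ∈ parityCheckCode (parityCheckMatrix n b α) ↔
      evalVec n α v = 0 ∧ evalVec n (α ^ b) v = 0 := by
  change (parityCheckMatrix n b α).mulVec (fun j => algebraMap (ZMod 2) F (v j)) = 0 ↔ _
  rw [funext_iff, Fin.forall_fin_two]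
  simp [Matrix.mulVec, dotProduct, parityCheckMatrix, evalVec_apply, Algebra.smul_def, mul_comm]

lemma natDegree_minpoly_of_adjoin_eq_top [Finite F] {α : F}
    (hgen : Algebra.adjoin (ZMod 2) {α} = ⊤) :
    (minpoly (ZMod 2) α).natDegree = Module.finrank (ZMod 2) F := by
  have hint : IsIntegral (ZMod 2) α := Algebra.IsIntegral.isIntegral α
  rw [← IntermediateField.adjoin.finrank hint]
  have : IntermediateField.adjoin (ZMod 2) {α} = ⊤ := by
    rw [eq_top_iff]
    intro x _
    exact IntermediateField.algebra_adjoin_le_adjoin (ZMod 2) {α} (hgen ▸ Algebra.mem_top)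
  rw [this, IntermediateField.finrank_top']

/-- A polynomial of degree less than `m + 2` over `𝔽₂` is determined by its values at a generator
of `𝔽_{2^m}` and at a primitive cube root of unity. -/
lemma eq_zero_of_aeval_eq_zero [Finite F] {m : ℕ} {α ω : F}
    (hF : Module.finrank (ZMod 2) F = m) (hm : 2 < m)
    (hgen : Algebra.adjoin (ZMod 2) {α} = ⊤) (hω : ω ^ 2 + ω + 1 = 0)
    {p : Polynomial (ZMod 2)} (hdeg : p.degree < (m + 2 : ℕ))
    (hpα : Polynomial.aeval α p = 0) (hpω : Polynomial.aeval ω p = 0) : p = 0 := by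
  open Polynomial in
  have hint : IsIntegral (ZMod 2) α := Algebra.IsIntegral.isIntegral α
  have hdα : (minpoly (ZMod 2) α).natDegree = m := by
    rw [natDegree_minpoly_of_adjoin_eq_top hgen, hF]
  have hωα : aeval ω (minpoly (ZMod 2) α) ≠ 0 := by
    -- Otherwise the minimal polynomial of `α`, of degree `m > 2`, would divide `X ^ 2 + X + 1`.
    intro h
    have heq := minpoly.eq_of_irreducible_of_monic (minpoly.irreducible hint) h (minpoly.monic hint)
    have hq : aeval ω (X ^ 2 + X + 1 : (ZMod 2)[X]) = 0 := by simpa using hω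
    have hqd : (X ^ 2 + X + 1 : (ZMod 2)[X]).natDegree = 2 := by compute_degree!
    have hq0 : (X ^ 2 + X + 1 : (ZMod 2)[X]) ≠ 0 := by
      intro h0
      rw [h0] at hqd
      simp at hqd
    have := natDegree_le_of_dvd (minpoly.dvd (ZMod 2) ω hq) hq0
    rw [← heq, hdα, hqd] at this
    omega
  obtain ⟨q, rfl⟩ := minpoly.dvd (ZMod 2) α hpα
  have hqω : aeval ω q = 0 := by
    rw [map_mul] at hpω
    exact (mul_eq_zero.1 hpω).resolve_left hωα
  by_contra hne
  have hq0 : q ≠ 0 := right_ne_zero_of_mul hne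
  have hqd : q.natDegree ≤ 1 := by
    have h := (natDegree_lt_iff_degree_lt hne).2 hdeg
    rw [natDegree_mul (left_ne_zero_of_mul hne) hq0, hdα] at h
    omega
  -- A nonzero `q` of degree at most 1 vanishing at `ω` would put `ω` in `𝔽₂`, where `X ^ 2 + X + 1`
  -- has no root.
  rw [eq_X_add_C_of_natDegree_le_one hqd] at hqω
  have hchar : CharP F 2 := charP_of_injective_algebraMap (algebraMap (ZMod 2) F).injective 2
  have h2 : (2 : F) = 0 := CharTwo.two_eq_zero
  simp only [map_add, map_mul, aeval_C, aeval_X] at hqω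
  apply hq0
  rw [eq_X_add_C_of_natDegree_le_one hqd]
  rcases zmod_two_cases (q.coeff 1) with h1 | h1 <;>
    rcases zmod_two_cases (q.coeff 0) with h0 | h0 <;> simp [h0, h1] at hqω ⊢
  · simp [hqω] at hω
  · have : ω = 1 := by linear_combination hqω - h2
    rw [this] at hω
    exact absurd (by linear_combination hω - h2 : (1 : F) = 0) one_ne_zero

lemma finrank_parityCheckCode [Finite F] {m n b : ℕ} {α : F}
    (hF : Module.finrank (ZMod 2) F = m) (hm : 2 < m) (hn : m + 2 ≤ n)
    (hgen : Algebra.adjoin (ZMod 2) {α} = ⊤) (hω : (α ^ b) ^ 2 + α ^ b + 1 = 0) :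
    Module.finrank (ZMod 2) (parityCheckCode (parityCheckMatrix n b α)) + (m + 2) = n := by
  set ω := α ^ b with hωdef
  let g : (Fin n → ZMod 2) →ₗ[ZMod 2] F × F := (evalVec n α).prod (evalVec n ω)
  have hker : parityCheckCode (parityCheckMatrix n b α) = LinearMap.ker g := by
    ext v
    simp [mem_parityCheckCode_iff, g, hωdef]
  have hchar : CharP F 2 := charP_of_injective_algebraMap (algebraMap (ZMod 2) F).injective 2
  have h2 : (2 : F) = 0 := CharTwo.two_eq_zero
  have hrank : Module.finrank (ZMod 2) (LinearMap.range g) = m + 2 := by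
    apply le_antisymm
    -- `K` is the subfield `𝔽₄`, which contains all powers of `ω`; the second row thus adds at most
    -- 2 to the rank.
    · let K : Submodule (ZMod 2) F := Submodule.span (ZMod 2) {1, ω}
      have hpow : ∀ j : ℕ, ω ^ j ∈ K := by
        intro j
        have h1 : (1 : F) ∈ K := Submodule.subset_span (by simp)
        have hw : ω ∈ K := Submodule.subset_span (by simp)
        have hsq : ω ^ 2 = ω + 1 := by linear_combination hω - (ω + 1) * h2
        have : ω ^ j ∈ K ∧ ω ^ (j + 1) ∈ K := by
          induction j with
          | zero => exact ⟨by simpa using h1, by simpa using hw⟩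
          | succ j ih =>
            refine ⟨ih.2, ?_⟩
            have : ω ^ (j + 1 + 1) = ω ^ (j + 1) + ω ^ j := by linear_combination ω ^ j * hsq
            rw [this]
            exact K.add_mem ih.2 ih.1
        exact this.1
      have hle : LinearMap.range g ≤ LinearMap.range (LinearMap.id.prodMap K.subtype) := by
        rintro _ ⟨v, rfl⟩
        have hv : evalVec n ω v ∈ K := by
          rw [evalVec_apply]
          exact K.sum_mem fun j _ => K.smul_mem _ (hpow j)
        exact ⟨(evalVec n α v, ⟨_, hv⟩), rfl⟩
      have hK : Module.finrank (ZMod 2) K ≤ 2 := by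
        classical
        have := finrank_span_finset_le_card (R := ZMod 2) ({1, ω} : Finset F)
        rw [Finset.coe_insert, Finset.coe_singleton] at this
        exact this.trans Finset.card_le_two
      calc Module.finrank (ZMod 2) (LinearMap.range g)
          ≤ Module.finrank (ZMod 2) (F × K) :=
            (Submodule.finrank_mono hle).trans (LinearMap.finrank_range_le _)
        _ ≤ m + 2 := by rw [Module.finrank_prod]; omega
    · have hli : LinearIndependent (ZMod 2)
          fun j : Fin (m + 2) => ((α ^ (j : ℕ), ω ^ (j : ℕ)) : F × F) := by
        rw [Fintype.linearIndependent_iff]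
        intro c hc
        rw [Prod.ext_iff, Prod.fst_sum, Prod.snd_sum] at hc
        let p : Polynomial (ZMod 2) := ∑ j : Fin (m + 2), Polynomial.C (c j) * Polynomial.X ^ (j : ℕ)
        have hcoeff : ∀ j : Fin (m + 2), p.coeff j = c j := fun j => by
          simp [p, Polynomial.finsetSum_coeff, Polynomial.coeff_X_pow, ← Fin.ext_iff]
        have hdeg : p.degree < (m + 2 : ℕ) := by
          refine (Polynomial.degree_sum_le _ _).trans_lt ?_
          rw [Finset.sup_lt_iff (WithBot.bot_lt_coe _)]
          exact fun j _ => (Polynomial.degree_C_mul_X_pow_le _ _).trans_lt (by exact_mod_cast j.2)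
        have hpα : Polynomial.aeval α p = 0 := by
          simpa [p, Algebra.smul_def] using hc.1
        have hpω : Polynomial.aeval ω p = 0 := by
          simpa [p, Algebra.smul_def] using hc.2
        have hp0 := eq_zero_of_aeval_eq_zero hF hm hgen hω hdeg hpα hpω
        intro j
        rw [← hcoeff, hp0, Polynomial.coeff_zero]
      have h := finrank_span_eq_card hli
      rw [Fintype.card_fin] at h
      rw [← h]
      refine Submodule.finrank_mono (Submodule.span_le.2 ?_)
      rintro _ ⟨j, rfl⟩
      refine ⟨unitVec ⟨j, by omega⟩, ?_⟩
      simp [g, evalVec_unitVec]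
  have h := LinearMap.finrank_range_add_finrank_ker g
  rw [hrank, Module.finrank_fin_fun] at h
  rw [hker]
  omega

lemma modEq_of_pow_eq_pow {M : Type*} [CommMonoid M] {β : M} {k l m : ℕ} (hβ : IsPrimitiveRoot β k)
    (hk : 0 < k) (h : β ^ l = β ^ m) : l ≡ m [MOD k] := by
  rw [pow_eq_pow_mod l hβ.pow_eq_one, pow_eq_pow_mod m hβ.pow_eq_one] at h
  exact hβ.pow_inj (Nat.mod_lt _ hk) (Nat.mod_lt _ hk) h

lemma inducedVec_add_inducedVec_notMem {n b : ℕ} (hn : 3 ≤ n) {α : F}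
    (hα : IsPrimitiveRoot α n) (hb : n = 3 * b) (hb1 : 1 < b)
    (hlog : ¬ discreteLog α (1 + α) ≡ 2 [MOD 3]) (hex : 1 + α ≠ 0 → ∃ l, α ^ l = 1 + α)
    (hω : (α ^ b) ^ 2 + α ^ b + 1 = 0) {i j : Fin n} (hij : i ≠ j) {P Q : Pauli}
    (hP : P ≠ Pauli.I) :
    inducedVec (lattice n) i P + inducedVec (lattice n) j Q ∉
      parityCheckCode (parityCheckMatrix n b α) := by
  have hchar : CharP F 2 := charP_of_injective_algebraMap (algebraMap (ZMod 2) F).injective 2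
  have h2 : (2 : F) = 0 := CharTwo.two_eq_zero
  have hω3 : IsPrimitiveRoot (α ^ b) 3 := hα.pow (by omega) (by omega)
  have hα0 : α ≠ 0 := hα.ne_zero (by omega)
  have hωn : (α ^ b) ^ n = 1 := by rw [← pow_mul, mul_comm, pow_mul, hα.pow_eq_one, one_pow]
  have hω0 : α ^ b ≠ 0 := pow_ne_zero _ hα0
  have hne : α ^ (i : ℕ) ≠ α ^ (j : ℕ) := fun h => hij (Fin.ext (hα.pow_inj i.2 j.2 h))
  have hne' : α ^ (i : ℕ) + α ^ (j : ℕ) ≠ 0 := fun h => hne (by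
    linear_combination h - α ^ (j : ℕ) * h2)
  have hα1 : 1 + α ≠ 0 := fun h => hα.ne_one (by omega) (by linear_combination h - h2)
  have hαsq : α ^ 2 + 1 ≠ 0 := fun h => hα1 (pow_eq_zero_iff (two_ne_zero) |>.1 (by
    linear_combination h + α * h2 : (1 + α) ^ 2 = 0))
  -- Needs `n > 3`: a root of `X ^ 2 + X + 1` has order dividing 3.
  have hY : α ^ 2 + α + 1 ≠ 0 := fun h => hα.pow_ne_one_of_pos_of_lt (l := 3) (by omega) (by omega)
    (by linear_combination (α - 1) * h)
  obtain ⟨l, hl⟩ := hex hα1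
  -- The set of exponents is nonempty, so the infimum is not the default value 0 of an empty set.
  have hL : α ^ discreteLog α (1 + α) = 1 + α := Nat.sInf_mem (s := {l | α ^ l = 1 + α}) ⟨l, hl⟩
  generalize discreteLog α (1 + α) = L at hlog hL
  have hXZ : ∀ i j : Fin n, (α ^ b) ^ (i : ℕ) = (α ^ b) ^ (j : ℕ) →
      α ^ (i : ℕ) * (α + α⁻¹) ≠ α ^ (j : ℕ) := by
    intro i j h h'
    -- Here `α + α⁻¹ = (1 + α)² / α`. Modulo 3, where `i ≡ j`, the equality of exponents becomes `2
    -- L ≡ 1`, that is `L ≡ 2`.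
    have h3 : α ^ ((i : ℕ) + 2 * L) = α ^ ((j : ℕ) + 1) := by
      rw [pow_add, mul_comm 2 L, pow_mul, hL, pow_succ α, ← h']
      field_simp
      linear_combination α * h2
    have hmod := (modEq_of_pow_eq_pow hα (by omega) h3).of_dvd ⟨b, hb⟩
    have hmod' := modEq_of_pow_eq_pow hω3 (by omega) h
    unfold Nat.ModEq at *
    omega
  have e1 : ∀ i, evalVec n α (neighborVec (lattice n) i) = α ^ (i : ℕ) * (α + α⁻¹) :=
    evalVec_neighborVec hn hα.pow_eq_one
  have e2 : ∀ i, evalVec n (α ^ b) (neighborVec (lattice n) i) = (α ^ b) ^ (i : ℕ) := by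
    intro i
    rw [evalVec_neighborVec hn hωn]
    have : α ^ b + (α ^ b)⁻¹ = 1 := by
      field_simp
      linear_combination hω - α ^ b * h2
    rw [this, mul_one]
  rw [mem_parityCheckCode_iff]
  rintro ⟨hA, hB⟩
  have hi := pow_ne_zero (i : ℕ) hω0
  have hj := pow_ne_zero (j : ℕ) hω0
  have hαi := pow_ne_zero (i : ℕ) hα0
  have hYi : ∀ x : F, x * (α + α⁻¹) + x = 0 → x = 0 := by
    intro x hx
    have : x * (α ^ 2 + α + 1) = 0 := by
      have hinv : α * α⁻¹ = 1 := mul_inv_cancel₀ hα0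
      linear_combination α * hx - x * hinv
    exact (mul_eq_zero.1 this).resolve_right hY
  have hXi : ∀ x : F, x * (α + α⁻¹) = 0 → x = 0 := by
    intro x hx
    have : x * (α ^ 2 + 1) = 0 := by
      have hinv : α * α⁻¹ = 1 := mul_inv_cancel₀ hα0
      linear_combination α * hx - x * hinv
    exact (mul_eq_zero.1 this).resolve_right hαsq
  have hdbl : ∀ x : F, x + x = 0 := CharTwo.add_self_eq_zero
  cases P <;> cases Q <;>
    simp only [inducedVec, map_add, map_zero, e1, e2, evalVec_unitVec, add_zero, zero_add,
      hdbl] at hA hB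
  -- The value at `ω` rules out an `X` or `Z` alone or paired with a `Y`. A single `Y` and pairs of
  -- equal type are ruled out at `α`; a mixed `X`, `Z` pair needs both values.
  all_goals first
    | exact hP rfl
    | exact hi hB
    | exact hj hB
    | exact hαi (hYi _ hA)
    | exact hne' hA
    | exact hne' (hXi _ (by linear_combination hA))
    | exact hne' (hYi _ (by linear_combination hA))
    | exact hXZ i j (CharTwo.add_eq_zero.1 hB) (CharTwo.add_eq_zero.1 hA)
    | exact hXZ j i (CharTwo.add_eq_zero.1 hB).symm (CharTwo.add_eq_zero.1 hA).symm

end Code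

end CWS

theorem theorem3 (r : ℕ) (hr : 2 ≤ r) {F : Type*} [Field F] [Fintype F] [Algebra (ZMod 2) F]
    (hF : Fintype.card F = 2 ^ (2 * r)) (α : F) (hα : IsPrimitiveRoot α (2 ^ (2 * r) - 1))
    (hlog : ¬ CWS.discreteLog α (1 + α) ≡ 2 [MOD 3])
    (G : CWS.QubitSpace (2 ^ (2 * r) - 1))
    (hG : CWS.IsGraphState (CWS.lattice (2 ^ (2 * r) - 1)) G) :
    CWS.IsPureQECC (2 ^ (2 * r) - 1) (2 ^ (2 * r) - 2 * r - 3) 3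
      (CWS.cwsCode G (CWS.tentPegCode r α)) := by
  have h4 : 2 ^ (2 * r) = 4 ^ r := by rw [pow_mul]; norm_num
  have hpos : 16 ≤ 2 ^ (2 * r) :=
    (by norm_num : 16 = 2 ^ 4) ▸ Nat.pow_le_pow_right (by norm_num) (by omega)
  -- Ensures that the natural subtraction in `k` does not truncate and that the length is at least
  -- the rank `2r + 2`.
  have hbig : 2 * r + 3 ≤ 2 ^ (2 * r) := by
    have := Nat.lt_two_pow_self (n := 2 * r - 1)
    have h : 2 ^ (2 * r) = 2 * 2 ^ (2 * r - 1) := by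
      rw [← pow_succ', Nat.sub_add_cancel (by omega)]
    omega
  have hb : 2 ^ (2 * r) - 1 = 3 * ((2 ^ (2 * r) - 1) / 3) := by
    have : 3 ∣ 4 ^ r - 1 := by simpa using Nat.sub_dvd_pow_sub_pow 4 1 r
    rw [h4]
    omega
  have hfin : Module.finrank (ZMod 2) F = 2 * r := by
    have h := Module.card_eq_pow_finrank (K := ZMod 2) (V := F)
    rw [hF, ZMod.card] at h
    exact (Nat.pow_right_injective le_rfl h).symm
  have hpow : ∀ x : F, x ≠ 0 → ∃ l, α ^ l = x := by
    intro x hx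
    have : NeZero (2 ^ (2 * r) - 1) := ⟨by omega⟩
    obtain ⟨l, -, hl⟩ := hα.eq_pow_of_pow_eq_one (hF ▸ FiniteField.pow_card_sub_one_eq_one x hx)
    exact ⟨l, hl⟩
  have hgen : Algebra.adjoin (ZMod 2) {α} = ⊤ := by
    rw [eq_top_iff]
    intro x _
    by_cases hx : x = 0
    · rw [hx]
      exact Subalgebra.zero_mem _
    · obtain ⟨l, rfl⟩ := hpow x hx
      exact Subalgebra.pow_mem _ (Algebra.self_mem_adjoin_singleton _ _) _
  have hω : (α ^ ((2 ^ (2 * r) - 1) / 3)) ^ 2 + α ^ ((2 ^ (2 * r) - 1) / 3) + 1 = 0 := by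
    have h3 : IsPrimitiveRoot (α ^ ((2 ^ (2 * r) - 1) / 3)) 3 :=
      hα.pow (by omega) (hb.trans (mul_comm _ _))
    have h := h3.geom_sum_eq_zero (by norm_num)
    simp only [Finset.sum_range_succ, Finset.sum_range_zero] at h
    linear_combination h
  refine hG.isPureQECC_cwsCode (by omega) _ ?_ fun i j P Q hij hP =>
    CWS.inducedVec_add_inducedVec_notMem (by omega) hα hb (by omega) hlog (hpow _) hω hij hP
  have h := CWS.finrank_parityCheckCode (n := 2 ^ (2 * r) - 1) (b := (2 ^ (2 * r) - 1) / 3)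
    hfin (by omega) (by omega) hgen hω
  rw [CWS.tentPegCode]
  omega
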